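/- Let $\sigma_+,\sigma_-\in\mathbb{R}$ and let $\alpha,\beta\in\mathbb{C}$ with $|\alpha|^2+|\beta|^2=1$. Consider the two-phase quantum walk with one defect on $\mathbb{Z}$, whose coin at position $x$ is $$U_x=\frac1{\sqrt2}\begin{bmatrix}1&e^{i\sigma_+}\\ e^{-i\sigma_+}&-1\end{bmatrix}\ (x\ge1),\qquad U_x=\frac1{\sqrt2}\begin{bmatrix}1&e^{i\sigma_-}\\ e^{-i\sigma_-}&-1\end{bmatrix}\ (x\le-1),\qquad U_0=\begin{bmatrix}1&0\\0&-1\end{bmatrix}.$$ Let $P_x$ (respectively $Q_x$) be the matrix obtained from $U_x$ by replacing its lower (respectively upper) row by zeros. The amplitudes $\Psi_t(x)\in\mathbb{C}^2$ are given by $\Psi_0(0)={}^T[\alpha,\beta]$, $\Psi_0(x)=0$ for $x\ne0$, and $\Psi_t(x)=Q_{x-1}\Psi_{t-1}(x-1)+P_{x+1}\Psi_{t-1}(x+1)$ for $t\ge1$, and $P(X_t=x)=\|\Psi_t(x)\|^2$. Put $\sigma=(\sigma_+-\sigma_-)/2$ and $\tilde\sigma=(\sigma_++\sigma_-)/2$.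 Then for every $x\in\mathbb{Z}$ the limit $$\overline\mu_\infty(x)=\lim_{T\to\infty}\frac1T\sum_{t=0}^{T-1}P(X_t=x)$$ exists, and $$\overline\mu_\infty(x)=I_{\{-1/\sqrt2\le\sin\sigma\le1\}}\,\nu^{(+)}(x;\sigma)+I_{\{-1\le\sin\sigma\le1/\sqrt2\}}\,\nu^{(-)}(x;\sigma),$$ where $I_{\{\cdot\}}$ is $1$ if the condition holds and $0$ otherwise, and $$\nu^{(\pm)}(x;\sigma)=\left(\frac{1\pm\sqrt2\sin\sigma}{3\pm2\sqrt2\sin\sigma}\right)^2\left\{1\mp2\,\Re\!\left(ie^{-i\tilde\sigma}\alpha\overline\beta\right)\right\}\left\{\delta_0(x)+(1-\delta_0(x))(2\pm\sqrt2\sin\sigma)\left(\frac1{3\pm2\sqrt2\sin\sigma}\right)^{|x|}\right\},$$ with $\delta_0(0)=1$ and $\delta_0(x)=0$ for $x\neq0$. Moreover, $\overline\mu_\infty(-x)=\overline\mu_\infty(x)$ for all $x\in\mathbb{Z}$, and there are constants $C>0$ and $0<r<1$ (depending on $\sigma_\pm,\alpha,\beta$) with $0\le\overline\mu_\infty(x)\le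 C\,r^{|x|}$ for all $x\in\mathbb{Z}$. -/

import Mathlib

open Filter Topology

noncomputable section

namespace TwoPhaseWalk

/-- The coin matrix at position `x` of the two-phase quantum walk with one defect, with phases
`σp` on the positive half line and `σm` on the negative half line. -/
def coin (σp σm : ℝ) (x : ℤ) : Matrix (Fin 2) (Fin 2) ℂ :=
  if 1 ≤ x then
    ((1 / √2 : ℝ) : ℂ) •
      !![1, Complex.exp (Complex.I * σp); Complex.exp (-(Complex.I * σp)), -1]
  else if x ≤ -1 then
    ((1 / √2 : ℝ) : ℂ) •
      !![1, Complex.exp (Complex.I * σm); Complex.exp (-(Complex.I * σm)), -1]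
  else !![1, 0; 0, -1]

/-- The part of a coin matrix that moves the walker one step to the left (its upper row). -/
def leftPart (U : Matrix (Fin 2) (Fin 2) ℂ) : Matrix (Fin 2) (Fin 2) ℂ :=
  !![U 0 0, U 0 1; 0, 0]

/-- The part of a coin matrix that moves the walker one step to the right (its lower row). -/
def rightPart (U : Matrix (Fin 2) (Fin 2) ℂ) : Matrix (Fin 2) (Fin 2) ℂ :=
  !![0, 0; U 1 0, U 1 1]

/-- One step of the walk: the coin at each site acts on the amplitude at that site, and then the
left component moves one site to the left and the right component one site to the right. -/
def step (σp σm : ℝ) (Ψ : ℤ → Fin 2 → ℂ) : ℤ → Fin 2 → ℂ := fun x =>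
  (rightPart (coin σp σm (x - 1))).mulVec (Ψ (x - 1)) +
    (leftPart (coin σp σm (x + 1))).mulVec (Ψ (x + 1))

/-- The initial amplitude: the state `ᵀ[α, β]` at the origin and zero elsewhere. -/
def initial (α β : ℂ) : ℤ → Fin 2 → ℂ := fun x => if x = 0 then ![α, β] else 0

/-- The amplitude `Ψ_t` at time `t`; component `0` is the left one, component `1` the right one. -/
def amplitude (σp σm : ℝ) (α β : ℂ) (t : ℕ) : ℤ → Fin 2 → ℂ :=
  (step σp σm)^[t] (initial α β)

/-- The probability `P(X_t = x)` of finding the walker at `x` at time `t`. -/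
def prob (σp σm : ℝ) (α β : ℂ) (t : ℕ) (x : ℤ) : ℝ :=
  ‖amplitude σp σm α β t x 0‖ ^ 2 + ‖amplitude σp σm α β t x 1‖ ^ 2

/-- `μ` is the time-averaged limit measure of a family `p t x = P(X_t = x)` of distributions:
at every site the averages over the times `0, …, T - 1` converge to `μ` as `T → ∞`. -/
def IsTimeAveragedLimitMeasure (p : ℕ → ℤ → ℝ) (μ : ℤ → ℝ) : Prop :=
  ∀ x : ℤ, Tendsto (fun T : ℕ => (1 / (T : ℝ)) * ∑ t ∈ Finset.range T, p t x) atTop (𝓝 (μ x))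

/-- The function `δ₀` on the integers. -/
def delta0 (x : ℤ) : ℝ := if x = 0 then 1 else 0

/-- The weight `ν⁽⁺⁾(x; σ)`, where `τ` stands for `σ̃`. -/
def nuPlus (σ τ : ℝ) (α β : ℂ) (x : ℤ) : ℝ :=
  ((1 + √2 * Real.sin σ) / (3 + 2 * √2 * Real.sin σ)) ^ 2 *
    (1 - 2 * (Complex.I * Complex.exp (-(Complex.I * τ)) * α * (starRingEnd ℂ) β).re) *
    (delta0 x + (1 - delta0 x) * (2 + √2 * Real.sin σ) *
      (1 / (3 + 2 * √2 * Real.sin σ)) ^ x.natAbs)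

/-- The weight `ν⁽⁻⁾(x; σ)`, where `τ` stands for `σ̃`. -/
def nuMinus (σ τ : ℝ) (α β : ℂ) (x : ℤ) : ℝ :=
  ((1 - √2 * Real.sin σ) / (3 - 2 * √2 * Real.sin σ)) ^ 2 *
    (1 + 2 * (Complex.I * Complex.exp (-(Complex.I * τ)) * α * (starRingEnd ℂ) β).re) *
    (delta0 x + (1 - delta0 x) * (2 - √2 * Real.sin σ) *
      (1 / (3 - 2 * √2 * Real.sin σ)) ^ x.natAbs)

end TwoPhaseWalk

end

/-! Encode the amplitudes at each site as a formal power series in time. On each homogeneous half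
line these series are geometric in the distance from the origin, governed by `refl`, a root of a
quadratic. At the origin there remains a 2×2 linear system with determinant 1 + pq·ret², where p =
e^{iσ₊} and q = e^{-iσ₋}. For γ with γ²pq = -1 the determinant is (1 - ret/γ)(1 + ret/γ). Since
`ret` is also a root of a quadratic, multiplying 1 - ret/γ by (conjugate root - γ) gives a constant
times 1 - X²/`poleSq γ`, whose two zeros lie on the unit circle (`one_sub_ret_mul_residue`).

So each amplitude series is a sum of four terms f/(1 - ηX) with |η| = 1, where f converges
absolutely on the unit circle because the coefficients of `refl` are absolutely summable
(`sum_norm_reflCoeff_le`). The amplitude at time t is therefore Σ f(η⁻¹)ηᵗ + o(1)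
(`tendsto_coeff_mul_geom`), and its averaged squared modulus tends to Σ |f(η⁻¹)|², provided the η
with nonzero coefficient are distinct (`tendsto_average_normSq`).

At η⁻¹ the value v of `refl` is one of two explicit numbers with product -1, and |v| ≤ 1 decides
between them by comparing Re γ with 1/√2 (`residueVal_dichotomy`). One choice makes the residue
vanish, which is the origin of the indicators; the other yields the weights. With γ = i e^{-iσ} one
has Re γ = sin σ; γ gives ν⁽⁻⁾ and -γ gives ν⁽⁺⁾. -/

noncomputable section

namespace TwoPhaseWalk

open PowerSeries (X C coeff mk)

/-! ### Evaluation of absolutely convergent power series -/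

/-- The power series `f` converges absolutely at `ζ`, with sum `v`. -/
structure AbsEval (ζ : ℂ) (f : PowerSeries ℂ) (v : ℂ) : Prop where
  summable : Summable fun n => ‖coeff n f * ζ ^ n‖
  hasSum : HasSum (fun n => coeff n f * ζ ^ n) v

namespace AbsEval

variable {ζ v w : ℂ} {f g : PowerSeries ℂ}

theorem add (hf : AbsEval ζ f v) (hg : AbsEval ζ g w) : AbsEval ζ (f + g) (v + w) := by
  have h : (fun n => coeff n (f + g) * ζ ^ n) =
      fun n => coeff n f * ζ ^ n + coeff n g * ζ ^ n := by
    funext n; rw [map_add, add_mul]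
  refine ⟨?_, h ▸ hf.hasSum.add hg.hasSum⟩
  refine Summable.of_nonneg_of_le (fun _ => norm_nonneg _) (fun n => ?_)
    (hf.summable.add hg.summable)
  rw [congrFun h n]
  exact norm_add_le _ _

theorem mul (hf : AbsEval ζ f v) (hg : AbsEval ζ g w) : AbsEval ζ (f * g) (v * w) := by
  have h : (fun n => coeff n (f * g) * ζ ^ n) = fun n =>
      ∑ kl ∈ Finset.HasAntidiagonal.antidiagonal n,
        (coeff kl.1 f * ζ ^ kl.1) * (coeff kl.2 g * ζ ^ kl.2) := by
    funext n
    rw [PowerSeries.coeff_mul, Finset.sum_mul]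
    refine Finset.sum_congr rfl fun kl hkl => ?_
    rw [← Finset.HasAntidiagonal.mem_antidiagonal.1 hkl, pow_add]
    ring
  have hs := summable_norm_sum_mul_antidiagonal_of_summable_norm hf.summable hg.summable
  have ht := tsum_mul_tsum_eq_tsum_sum_antidiagonal_of_summable_norm hf.summable hg.summable
  rw [hf.hasSum.tsum_eq, hg.hasSum.tsum_eq] at ht
  constructor
  · rw [funext fun n => congrArg norm (congrFun h n)]
    exact hs
  · rw [h, ht]
    exact hs.of_norm.hasSum

theorem const (ζ a : ℂ) : AbsEval ζ (C a) a := by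
  have h : ∀ n, n ≠ 0 → coeff n (C a) * ζ ^ n = 0 := fun n hn => by
    rw [PowerSeries.coeff_C, if_neg hn, zero_mul]
  refine ⟨summable_of_ne_finset_zero (s := {0}) fun n hn => ?_, ?_⟩
  · rw [h n (by simpa using hn), norm_zero]
  · simpa using hasSum_single 0 h

theorem one (ζ : ℂ) : AbsEval ζ 1 1 := by
  simpa using const ζ 1

theorem var (ζ : ℂ) : AbsEval ζ X ζ := by
  have h : ∀ n, n ≠ 1 → coeff n (X : PowerSeries ℂ) * ζ ^ n = 0 := fun n hn => by
    rw [PowerSeries.coeff_X, if_neg hn, zero_mul]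
  refine ⟨summable_of_ne_finset_zero (s := {1}) fun n hn => ?_, ?_⟩
  · rw [h n (by simpa using hn), norm_zero]
  · simpa using hasSum_single 1 h

theorem neg (hf : AbsEval ζ f v) : AbsEval ζ (-f) (-v) := by
  simpa using (const ζ (-1)).mul hf

theorem sub (hf : AbsEval ζ f v) (hg : AbsEval ζ g w) : AbsEval ζ (f - g) (v - w) := by
  simpa [sub_eq_add_neg] using hf.add hg.neg

theorem pow (hf : AbsEval ζ f v) (n : ℕ) : AbsEval ζ (f ^ n) (v ^ n) := by
  induction n with
  | zero => simpa using one ζ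
  | succ n ih => simpa [pow_succ] using ih.mul hf

theorem unique (hf : AbsEval ζ f v) (hg : AbsEval ζ f w) : v = w :=
  hf.hasSum.unique hg.hasSum

end AbsEval

/-! ### Coefficient asymptotics at a simple pole -/

/-- The geometric series `∑ ηⁿ Xⁿ`. -/
def geom (η : ℂ) : PowerSeries ℂ := mk fun n => η ^ n

theorem one_sub_mul_geom (η : ℂ) : (1 - C η * X) * geom η = 1 := by
  ext n
  rw [sub_mul, one_mul, mul_assoc, map_sub, PowerSeries.coeff_C_mul]
  cases n with
  | zero => simp [geom]
  | succ n =>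
    rw [PowerSeries.coeff_succ_X_mul]
    simp [geom, PowerSeries.coeff_one, pow_succ']

/-- The coefficients of an absolutely convergent series divided by `1 - ηX` are asymptotically
those of a geometric series, with the value of the series at `η⁻¹` as its amplitude. -/
theorem tendsto_coeff_mul_geom {f : PowerSeries ℂ} {η v : ℂ} (hη : ‖η‖ = 1)
    (hf : AbsEval η⁻¹ f v) :
    Tendsto (fun t => coeff t (f * geom η) - v * η ^ t) atTop (𝓝 0) := by
  have hη0 : η ≠ 0 := by rintro rfl; simp at hη
  -- Divided by ηᵗ, the coefficient is a partial sum of f at η⁻¹.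
  have h : ∀ t, coeff t (f * geom η) =
      (∑ n ∈ Finset.range (t + 1), coeff n f * η⁻¹ ^ n) * η ^ t := fun t => by
    rw [PowerSeries.coeff_mul, Finset.Nat.sum_antidiagonal_eq_sum_range_succ_mk, Finset.sum_mul]
    refine Finset.sum_congr rfl fun n hn => ?_
    have hn' : n ≤ t := Nat.lt_succ_iff.1 (Finset.mem_range.1 hn)
    rw [geom, PowerSeries.coeff_mk, mul_assoc]
    congr 1
    rw [inv_pow, eq_inv_mul_iff_mul_eq₀ (pow_ne_zero _ hη0), ← pow_add, Nat.add_sub_cancel' hn']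
  have ht := (hf.hasSum.tendsto_sum_nat.comp (tendsto_add_atTop_nat 1)).sub_const v
  rw [sub_self, tendsto_zero_iff_norm_tendsto_zero] at ht
  rw [tendsto_zero_iff_norm_tendsto_zero]
  refine ht.congr fun t => ?_
  rw [h, ← sub_mul, norm_mul, norm_pow, hη, one_pow, mul_one]
  rfl

/-! ### Time averages -/

/-- Time averages of the powers of a unimodular number other than `1` vanish in the limit. -/
theorem tendsto_average_pow {q : ℂ} (hq : ‖q‖ = 1) (hq1 : q ≠ 1) :
    Tendsto (fun T : ℕ => (T : ℂ)⁻¹ * ∑ t ∈ Finset.range T, q ^ t) atTop (𝓝 0) := by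
  have hb : Tendsto (fun T : ℕ => (T : ℝ)⁻¹ * (2 / ‖q - 1‖)) atTop (𝓝 0) := by
    simpa using (tendsto_inv_atTop_nhds_zero_nat (𝕜 := ℝ)).mul_const (2 / ‖q - 1‖)
  refine squeeze_zero_norm (fun T => ?_) hb
  rw [norm_mul, norm_inv, Complex.norm_natCast, geom_sum_eq hq1, norm_div]
  gcongr
  calc ‖q ^ T - 1‖ ≤ ‖q ^ T‖ + ‖(1 : ℂ)‖ := norm_sub_le _ _
    _ = 2 := by rw [norm_pow, hq]; norm_num

open scoped ComplexConjugate in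
/-- The time average of the squared modulus of an almost periodic trigonometric sum. -/
theorem tendsto_average_normSq_sum {ι : Type*} [Fintype ι] [DecidableEq ι] (v η : ι → ℂ)
    (hη : ∀ j, ‖η j‖ = 1) (hne : ∀ j k, j ≠ k → v j ≠ 0 → v k ≠ 0 → η j ≠ η k) :
    Tendsto (fun T : ℕ => (T : ℝ)⁻¹ * ∑ t ∈ Finset.range T, ‖∑ j, v j * η j ^ t‖ ^ 2) atTop
      (𝓝 (∑ j, ‖v j‖ ^ 2)) := by
  have hterm : ∀ j k, Tendsto (fun T : ℕ => (v j * conj (v k)) *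
      ((T : ℂ)⁻¹ * ∑ t ∈ Finset.range T, (η j * conj (η k)) ^ t)) atTop
      (𝓝 (if j = k then (v j * conj (v k)) else 0)) := by
    intro j k
    by_cases hjk : j = k
    · subst hjk
      rw [if_pos rfl, Complex.mul_conj (η j), Complex.normSq_eq_norm_sq, hη]
      refine tendsto_const_nhds.congr' ?_
      filter_upwards [eventually_ne_atTop 0] with T hT
      have : (T : ℂ) ≠ 0 := Nat.cast_ne_zero.2 hT
      simp [this]
    · rw [if_neg hjk]
      by_cases hj : v j = 0
      · simp [hj]
      by_cases hk : v k = 0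
      · simp [hk]
      have hkc : η k * conj (η k) = 1 := by
        rw [Complex.mul_conj, Complex.normSq_eq_norm_sq, hη]; simp
      have h1 : η j * conj (η k) ≠ 1 := fun h => hne j k hjk hj hk (by
        have h0 : conj (η k) ≠ 0 := right_ne_zero_of_mul_eq_one h
        exact mul_right_cancel₀ h0 (h.trans hkc.symm))
      have h2 : ‖η j * conj (η k)‖ = 1 := by simp [hη]
      simpa using (tendsto_average_pow h2 h1).const_mul (v j * conj (v k))
  have hsum := tendsto_finsetSum Finset.univ fun j _ =>
    tendsto_finsetSum Finset.univ fun k _ => hterm j k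
  have hre := (Complex.continuous_re.tendsto _).comp hsum
  convert hre using 1
  · funext T
    rw [Function.comp_apply, ← Complex.ofReal_re ((T : ℝ)⁻¹ * _)]
    congr 1
    push_cast
    have hsq : ∀ t, ((‖∑ j, v j * η j ^ t‖ : ℂ)) ^ 2 =
        ∑ j, ∑ k, (v j * conj (v k)) * (η j * conj (η k)) ^ t := fun t => by
      rw [← Complex.mul_conj', map_sum, Finset.sum_mul_sum]
      refine Finset.sum_congr rfl fun j _ => Finset.sum_congr rfl fun k _ => ?_
      rw [map_mul, map_pow, mul_pow]
      ring
    simp_rw [hsq]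
    rw [Finset.sum_comm, Finset.mul_sum]
    refine Finset.sum_congr rfl fun j _ => ?_
    rw [Finset.sum_comm, Finset.mul_sum]
    refine Finset.sum_congr rfl fun k _ => ?_
    rw [← Finset.mul_sum]
    ring
  · congr 1
    simp only [Finset.sum_ite_eq, Finset.mem_univ, if_true, Complex.re_sum]
    refine Finset.sum_congr rfl fun j _ => ?_
    rw [Complex.mul_conj, Complex.ofReal_re, Complex.normSq_eq_norm_sq]

/-- Time averages of squared moduli only depend on the asymptotics of the sequence. -/
theorem tendsto_average_normSq {ι : Type*} [Fintype ι] [DecidableEq ι] (a : ℕ → ℂ) (v η : ι → ℂ)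
    (hη : ∀ j, ‖η j‖ = 1) (hne : ∀ j k, j ≠ k → v j ≠ 0 → v k ≠ 0 → η j ≠ η k)
    (ha : Tendsto (fun t => a t - ∑ j, v j * η j ^ t) atTop (𝓝 0)) :
    Tendsto (fun T : ℕ => (1 / (T : ℝ)) * ∑ t ∈ Finset.range T, ‖a t‖ ^ 2) atTop
      (𝓝 (∑ j, ‖v j‖ ^ 2)) := by
  set b : ℕ → ℂ := fun t => ∑ j, v j * η j ^ t
  have hb : ∀ t, ‖b t‖ ≤ ∑ j, ‖v j‖ := fun t =>
    (norm_sum_le _ _).trans_eq (Finset.sum_congr rfl fun j _ => by simp [hη])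
  have hd := ha.norm
  rw [norm_zero] at hd
  have hdiff : Tendsto (fun t => ‖a t‖ ^ 2 - ‖b t‖ ^ 2) atTop (𝓝 0) := by
    have hbd : Tendsto (fun t => ‖a t - b t‖ * (‖a t - b t‖ + 2 * ∑ j, ‖v j‖)) atTop (𝓝 0) := by
      simpa using hd.mul (hd.add_const (2 * ∑ j, ‖v j‖))
    refine squeeze_zero_norm (fun t => ?_) hbd
    rw [sq_sub_sq, Real.norm_eq_abs, abs_mul, mul_comm]
    have h1 : |‖a t‖ - ‖b t‖| ≤ ‖a t - b t‖ := abs_norm_sub_norm_le _ _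
    have h2 : ‖a t‖ ≤ ‖a t - b t‖ + ‖b t‖ := by simpa using norm_add_le (a t - b t) (b t)
    have h3 : |‖a t‖ + ‖b t‖| ≤ ‖a t - b t‖ + 2 * ∑ j, ‖v j‖ := by
      rw [abs_of_nonneg (by positivity)]
      linarith [hb t]
    exact mul_le_mul h1 h3 (abs_nonneg _) (norm_nonneg _)
  have := hdiff.cesaro.add (tendsto_average_normSq_sum v η hη hne)
  rw [zero_add] at this
  refine this.congr fun T => ?_
  rw [one_div, ← mul_add, ← Finset.sum_add_distrib]
  simp [b]

/-! ### The reflection series -/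

/-- The coefficients of the reflection series. -/
def reflCoeff : ℕ → ℂ
  | 0 => 0
  | 1 => 0
  | n + 2 => (∑ i : Fin (n + 1), reflCoeff i * reflCoeff (n - i) - if n = 0 then 1 else 0) / 2
decreasing_by all_goals omega

theorem reflCoeff_add_two (n : ℕ) :
    reflCoeff (n + 2) =
      (∑ i ∈ Finset.range (n + 1), reflCoeff i * reflCoeff (n - i) -
        if n = 0 then 1 else 0) / 2 := by
  rw [reflCoeff, Finset.sum_range]

/-- The reflection series of a homogeneous half line: the generating function of the amplitudes
for returning to the end point, up to a phase. -/
def refl : PowerSeries ℂ := mk reflCoeff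

theorem two_mul_refl : 2 * refl = X ^ 2 * (refl ^ 2 - 1) := by
  ext n
  rw [← map_ofNat (C (R := ℂ)) 2, PowerSeries.coeff_C_mul, pow_two X, mul_assoc]
  match n with
  | 0 => simp [refl, reflCoeff]
  | 1 => simp [refl, reflCoeff]
  | n + 2 =>
    rw [PowerSeries.coeff_succ_X_mul, PowerSeries.coeff_succ_X_mul, pow_two, map_sub,
      PowerSeries.coeff_mul, Finset.Nat.sum_antidiagonal_eq_sum_range_succ_mk,
      PowerSeries.coeff_one]
    simp only [refl, PowerSeries.coeff_mk]
    rw [reflCoeff_add_two]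
    ring

/-- The recursion bounds the partial sums S of the norms by S(n+2) ≤ (S(n)² + 1)/2, which preserves
S ≤ 1. -/
theorem sum_norm_reflCoeff_le (n : ℕ) : ∑ i ∈ Finset.range n, ‖reflCoeff i‖ ≤ 1 := by
  induction n using Nat.strong_induction_on with
  | _ n ih =>
  match n with
  | 0 => simp
  | 1 => simp [reflCoeff]
  | n + 2 =>
    rw [Finset.sum_range_succ', Finset.sum_range_succ']
    have h0 : ‖reflCoeff 0‖ = 0 := by simp [reflCoeff]
    have h1 : ‖reflCoeff (0 + 1)‖ = 0 := by simp [reflCoeff]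
    rw [h0, h1, add_zero, add_zero]
    have hP := ih n (by omega)
    have hP0 : 0 ≤ ∑ i ∈ Finset.range n, ‖reflCoeff i‖ := by positivity
    have hterm : ∀ k, ‖reflCoeff (k + 1 + 1)‖ ≤
        ((∑ i ∈ Finset.range (k + 1), ‖reflCoeff i‖ * ‖reflCoeff (k - i)‖) +
          if k = 0 then 1 else 0) / 2 := fun k => by
      rw [reflCoeff_add_two, norm_div, Complex.norm_ofNat]
      gcongr
      refine (norm_sub_le _ _).trans (add_le_add ((norm_sum_le _ _).trans_eq ?_) ?_)
      · simp only [norm_mul]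
      · split_ifs <;> simp
    have hone : ∑ k ∈ Finset.range n, (if k = 0 then (1 : ℝ) else 0) ≤ 1 := by
      rw [Finset.sum_ite_eq']
      split_ifs <;> norm_num
    -- The convolution runs over a triangle of index pairs inside the square whose sum is S(n)².
    have hconv : ∑ k ∈ Finset.range n,
        ∑ i ∈ Finset.range (k + 1), ‖reflCoeff i‖ * ‖reflCoeff (k - i)‖ ≤ 1 := by
      rw [Finset.sum_range_diag_flip n fun i j => ‖reflCoeff i‖ * ‖reflCoeff j‖]
      calc _ ≤ ∑ i ∈ Finset.range n, ∑ j ∈ Finset.range n, ‖reflCoeff i‖ * ‖reflCoeff j‖ := by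
            refine Finset.sum_le_sum fun i _ => Finset.sum_le_sum_of_subset_of_nonneg ?_ ?_
            · exact Finset.range_subset_range.2 (Nat.sub_le _ _)
            · intros; positivity
        _ ≤ 1 := by
            rw [← Finset.sum_mul_sum]
            exact mul_le_one₀ hP hP0 hP
    calc ∑ k ∈ Finset.range n, ‖reflCoeff (k + 1 + 1)‖ ≤ _ := Finset.sum_le_sum fun k _ => hterm k
      _ ≤ 1 := by
        rw [← Finset.sum_div, Finset.sum_add_distrib]
        linarith

theorem exists_absEval_refl {ζ : ℂ} (hζ : ‖ζ‖ = 1) : ∃ v, AbsEval ζ refl v ∧ ‖v‖ ≤ 1 := by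
  have hn : (fun n => ‖coeff n refl * ζ ^ n‖) = fun n => ‖reflCoeff n‖ := by
    funext n
    simp [refl, hζ]
  have hs : Summable fun n => ‖coeff n refl * ζ ^ n‖ := by
    rw [hn]
    exact summable_of_sum_range_le (fun _ => norm_nonneg _) sum_norm_reflCoeff_le
  refine ⟨_, ⟨hs, hs.of_norm.hasSum⟩, (norm_tsum_le_tsum_norm hs).trans ?_⟩
  rw [hn]
  exact Real.tsum_le_of_sum_range_le (fun _ => norm_nonneg _) sum_norm_reflCoeff_le

/-! ### Generating functions of the walk -/

/-- The generating function, up to a phase, of the amplitudes for leaving the origin to one side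
and returning to it for the first time. -/
def ret : PowerSeries ℂ := C (√2 : ℂ)⁻¹ * X ^ 2 * (1 + refl)

/-- The ratio of the generating functions at neighbouring sites of the right half line. -/
def ratio : PowerSeries ℂ := C (√2 : ℂ)⁻¹ * X * (refl - 1)

/-- The generating functions of the amplitudes, up to a factor common to all sites. -/
def numer (α β p q : ℂ) : ℤ → Fin 2 → PowerSeries ℂ
  | .ofNat 0 => ![C α - ret * C p * C β, C β + ret * C q * C α]
  | .ofNat (n + 1) => ![C p * refl * (-X * (C β + ret * C q * C α) * ratio ^ n),
      -X * (C β + ret * C q * C α) * ratio ^ n]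
  | .negSucc n => ![X * (C α - ret * C p * C β) * (-ratio) ^ n,
      -C q * refl * (X * (C α - ret * C p * C β) * (-ratio) ^ n)]

/-- The factor X makes each coefficient depend only on the previous ones, so the one-step equations
have a unique solution. -/
theorem amplitude_eq_coeff {σp σm : ℝ} {α β : ℂ} {Φ : ℤ → Fin 2 → PowerSeries ℂ}
    (h0 : ∀ x, Φ x 0 = C (initial α β x 0) + X * (C (coin σp σm (x + 1) 0 0) * Φ (x + 1) 0 +
      C (coin σp σm (x + 1) 0 1) * Φ (x + 1) 1))
    (h1 : ∀ x, Φ x 1 = C (initial α β x 1) + X * (C (coin σp σm (x - 1) 1 0) * Φ (x - 1) 0 +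
      C (coin σp σm (x - 1) 1 1) * Φ (x - 1) 1)) (t : ℕ) (x : ℤ) (i : Fin 2) :
    amplitude σp σm α β t x i = coeff t (Φ x i) := by
  induction t generalizing x i with
  | zero =>
    fin_cases i
    · simp [amplitude, h0 x]
    · simp [amplitude, h1 x]
  | succ t ih =>
    rw [amplitude, Function.iterate_succ_apply']
    change step σp σm (amplitude σp σm α β t) x i = _
    fin_cases i
    · simp [step, leftPart, rightPart, dotProduct, Fin.sum_univ_two, ih, h0 x]
    · simp [step, leftPart, rightPart, dotProduct, Fin.sum_univ_two, ih, h1 x]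

theorem coin_zero (σp σm : ℝ) : coin σp σm 0 = !![1, 0; 0, -1] := by
  simp [coin]

theorem coin_of_pos (σp σm : ℝ) {x : ℤ} (hx : 1 ≤ x) : coin σp σm x =
    ((1 / √2 : ℝ) : ℂ) •
      !![1, Complex.exp (Complex.I * σp); (Complex.exp (Complex.I * σp))⁻¹, -1] := by
  rw [coin, if_pos hx, Complex.exp_neg]

theorem coin_of_neg (σp σm : ℝ) {x : ℤ} (hx : x ≤ -1) : coin σp σm x =
    ((1 / √2 : ℝ) : ℂ) • !![1, (Complex.exp (-(Complex.I * σm)))⁻¹;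
      Complex.exp (-(Complex.I * σm)), -1] := by
  rw [coin, if_neg (by omega), if_pos hx, Complex.exp_neg, inv_inv]

theorem two_mul_inv_sqrt_two_sq : (C (√2 : ℂ)⁻¹) ^ 2 * 2 = (1 : PowerSeries ℂ) := by
  rw [← map_ofNat (C (R := ℂ)) 2, ← map_pow, ← map_mul, inv_pow, ← Complex.ofReal_pow]
  norm_num

theorem C_mul_C_inv {a : ℂ} (ha : a ≠ 0) : C a * C a⁻¹ = (1 : PowerSeries ℂ) := by
  rw [← map_mul, mul_inv_cancel₀ ha, map_one]

/-- At the origin the equations are solved by Cramer's rule with determinant inverse D. Moving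
outward, `ratio` propagates one component by its definition; the inward-moving component is
consistent because of the quadratic for `refl`. -/
theorem amplitude_eq_coeff_numer {σp σm : ℝ} {α β p q : ℂ} {D : PowerSeries ℂ}
    (hp : p = Complex.exp (Complex.I * σp)) (hq : q = Complex.exp (-(Complex.I * σm)))
    (hD : D * (1 + ret ^ 2 * C p * C q) = 1) (t : ℕ) (x : ℤ) (i : Fin 2) :
    amplitude σp σm α β t x i = coeff t (numer α β p q x i * D) := by
  have hp1 : C p * C p⁻¹ = (1 : PowerSeries ℂ) := C_mul_C_inv (hp ▸ Complex.exp_ne_zero _)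
  have hq1 : C q * C q⁻¹ = (1 : PowerSeries ℂ) := C_mul_C_inv (hq ▸ Complex.exp_ne_zero _)
  have hr := two_mul_inv_sqrt_two_sq
  have hl := two_mul_refl
  refine amplitude_eq_coeff (Φ := fun x i => numer α β p q x i * D) (fun x => ?_)
    (fun x => ?_) t x i
  · match x with
    | .ofNat 0 =>
      change _ = _ + X * (C (coin _ _ (Int.ofNat 1) 0 0) *
        (numer α β p q (Int.ofNat 1) 0 * D) +
        C (coin _ _ (Int.ofNat 1) 0 1) * (numer α β p q (Int.ofNat 1) 1 * D))
      rw [coin_of_pos _ _ (by simp), ← hp]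
      simp [initial, numer]
      simp only [ret] at hD ⊢
      linear_combination C α * hD
    | .ofNat (n + 1) =>
      change _ = _ + X * (C (coin _ _ (Int.ofNat (n + 2)) 0 0) *
        (numer α β p q (Int.ofNat (n + 2)) 0 * D) +
        C (coin _ _ (Int.ofNat (n + 2)) 0 1) * (numer α β p q (Int.ofNat (n + 2)) 1 * D))
      rw [coin_of_pos _ _ (by simp; omega), ← hp]
      have hx : Int.ofNat (n + 1) ≠ 0 := by simp; omega
      simp only [initial, if_neg hx]
      simp [numer]
      rw [pow_succ, ratio]
      linear_combination -(C p * X * (C β + ret * C q * C α) *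
        (C (√2 : ℂ)⁻¹ * X * (refl - 1)) ^ n * D) * (C (√2 : ℂ)⁻¹ ^ 2 * hl - refl * hr)
    | .negSucc 0 =>
      change _ = _ + X * (C (coin _ _ (Int.ofNat 0) 0 0) *
        (numer α β p q (Int.ofNat 0) 0 * D) +
        C (coin _ _ (Int.ofNat 0) 0 1) * (numer α β p q (Int.ofNat 0) 1 * D))
      rw [show coin σp σm (Int.ofNat 0) = _ from coin_zero σp σm]
      simp [initial, numer]
      ring
    | .negSucc (n + 1) =>
      change _ = _ + X * (C (coin _ _ (Int.negSucc n) 0 0) *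
        (numer α β p q (Int.negSucc n) 0 * D) +
        C (coin _ _ (Int.negSucc n) 0 1) * (numer α β p q (Int.negSucc n) 1 * D))
      rw [coin_of_neg _ _ (by omega), ← hq]
      simp [initial, numer]
      rw [pow_succ]
      rw [ratio]
      linear_combination X * (C α - ret * C p * C β) *
        (-(C (√2 : ℂ)⁻¹ * X * (refl - 1))) ^ n * D * X * C (√2 : ℂ)⁻¹ * refl * hq1
  · match x with
    | .ofNat 0 =>
      change _ = _ + X * (C (coin _ _ (Int.negSucc 0) 1 0) *
        (numer α β p q (Int.negSucc 0) 0 * D) +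
        C (coin _ _ (Int.negSucc 0) 1 1) * (numer α β p q (Int.negSucc 0) 1 * D))
      rw [coin_of_neg _ _ (by omega), ← hq]
      simp [initial, numer]
      simp only [ret] at hD ⊢
      linear_combination C β * hD
    | .ofNat 1 =>
      change _ = _ + X * (C (coin _ _ (Int.ofNat 0) 1 0) *
        (numer α β p q (Int.ofNat 0) 0 * D) +
        C (coin _ _ (Int.ofNat 0) 1 1) * (numer α β p q (Int.ofNat 0) 1 * D))
      rw [show coin σp σm (Int.ofNat 0) = _ from coin_zero σp σm]
      simp [initial, numer]
      ring
    | .ofNat (n + 2) =>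
      have e : Int.ofNat (n + 2) - 1 = Int.ofNat (n + 1) := by simp; omega
      rw [e, coin_of_pos _ _ (by simp), ← hp]
      have hx : Int.ofNat (n + 2) ≠ 0 := by simp; omega
      simp only [initial, if_neg hx]
      simp [numer]
      rw [pow_succ]
      rw [ratio]
      linear_combination X * (C β + ret * C q * C α) *
        (C (√2 : ℂ)⁻¹ * X * (refl - 1)) ^ n * D * X * C (√2 : ℂ)⁻¹ * refl * hp1
    | .negSucc n =>
      have e : Int.negSucc n - 1 = Int.negSucc (n + 1) := by omega
      rw [e, coin_of_neg _ _ (by omega), ← hq]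
      simp [initial, numer]
      rw [pow_succ]
      rw [ratio]
      linear_combination -(C q * X * (C α - ret * C p * C β) *
        (-(C (√2 : ℂ)⁻¹ * X * (refl - 1))) ^ n * D) * (C (√2 : ℂ)⁻¹ ^ 2 * hl - refl * hr)

/-! ### Location of the poles on the unit circle -/

open scoped ComplexConjugate

theorem sqrt_two_sq : (√2 : ℂ) ^ 2 = 2 := by
  rw [← Complex.ofReal_pow]
  norm_num

theorem sqrt_two_ne_zero : (√2 : ℂ) ≠ 0 := by
  rw [Ne, Complex.ofReal_eq_zero]
  positivity

theorem normSq_sqrt_two_sub {γ : ℂ} (hγ : ‖γ‖ = 1) : ‖(√2 : ℂ) - γ‖ ^ 2 = 3 - 2 * √2 * γ.re := by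
  have h : γ.re * γ.re + γ.im * γ.im = 1 := by
    rw [← Complex.normSq_apply, Complex.normSq_eq_norm_sq, hγ, one_pow]
  have h2 : √2 * √2 = 2 := Real.mul_self_sqrt (by norm_num)
  rw [← Complex.normSq_eq_norm_sq, Complex.normSq_apply]
  simp only [Complex.sub_re, Complex.sub_im, Complex.ofReal_re, Complex.ofReal_im]
  linear_combination h + h2

theorem sqrt_two_gt : (1.41 : ℝ) < √2 := by
  rw [Real.lt_sqrt (by norm_num)]
  norm_num

theorem sqrt_two_lt : √2 < (1.42 : ℝ) := by
  rw [Real.sqrt_lt' (by norm_num)]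
  norm_num

theorem three_sub_pos {c : ℝ} (hc : c ≤ 1) : 0 < 3 - 2 * √2 * c := by
  nlinarith [sqrt_two_lt, Real.sqrt_nonneg 2]

theorem re_le_one {γ : ℂ} (hγ : ‖γ‖ = 1) : γ.re ≤ 1 := hγ ▸ Complex.re_le_norm γ

theorem sqrt_two_sub_ne_zero {γ : ℂ} (hγ : ‖γ‖ = 1) : (√2 : ℂ) - γ ≠ 0 := by
  have h := normSq_sqrt_two_sub hγ
  have h' := three_sub_pos (re_le_one hγ)
  intro h0
  rw [h0] at h
  norm_num at h
  linarith

theorem norm_one_sub_sqrt_two_mul {γ : ℂ} (hγ : ‖γ‖ = 1) :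
    ‖1 - (√2 : ℂ) * γ‖ = ‖(√2 : ℂ) - γ‖ := by
  rw [← sq_eq_sq₀ (norm_nonneg _) (norm_nonneg _), normSq_sqrt_two_sub hγ]
  have h : γ.re * γ.re + γ.im * γ.im = 1 := by
    rw [← Complex.normSq_apply, Complex.normSq_eq_norm_sq, hγ, one_pow]
  have h2 : √2 * √2 = 2 := Real.mul_self_sqrt (by norm_num)
  rw [← Complex.normSq_eq_norm_sq, Complex.normSq_apply]
  simp only [Complex.sub_re, Complex.sub_im, Complex.mul_re, Complex.mul_im, Complex.ofReal_re,
    Complex.ofReal_im, Complex.one_re, Complex.one_im]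
  linear_combination (√2 * √2) * h + h2

/-- The squared position on the unit circle at which the first return series would take the
unimodular value `γ`. -/
def poleSq (γ : ℂ) : ℂ := γ * (√2 - γ) / (1 - √2 * γ)

theorem poleSq_mul {γ : ℂ} (hγ : ‖γ‖ = 1) :
    poleSq γ * (1 - √2 * γ) = γ * (√2 - γ) := by
  have h : (1 : ℂ) - √2 * γ ≠ 0 := by
    rw [← norm_ne_zero_iff, norm_one_sub_sqrt_two_mul hγ, norm_ne_zero_iff]
    exact sqrt_two_sub_ne_zero hγ
  rw [poleSq, div_mul_cancel₀ _ h]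

theorem norm_poleSq {γ : ℂ} (hγ : ‖γ‖ = 1) : ‖poleSq γ‖ = 1 := by
  have h := norm_ne_zero_iff.2 (sqrt_two_sub_ne_zero hγ)
  rw [poleSq, norm_div, norm_mul, norm_one_sub_sqrt_two_mul hγ, hγ, one_mul, div_self h]

theorem ne_zero_of_norm {z : ℂ} (hz : ‖z‖ = 1) : z ≠ 0 := by
  rintro rfl
  simp at hz

theorem poleSq_ne_poleSq_neg {γ : ℂ} (hγ : ‖γ‖ = 1) (h : poleSq γ = poleSq (-γ)) :
    γ ^ 2 = 1 := by
  have h1 := poleSq_mul hγ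
  have h2 := poleSq_mul (γ := -γ) (by rwa [norm_neg])
  rw [← h] at h2
  have hγ0 := ne_zero_of_norm hγ
  have h3 : γ * (√2 * (γ ^ 2 - 1)) = 0 := by
    linear_combination ((1 + √2 * γ) / 2) * h1 - ((1 - √2 * γ) / 2) * h2
  have := (mul_eq_zero.1 ((mul_eq_zero.1 h3).resolve_left hγ0)).resolve_left sqrt_two_ne_zero
  exact sub_eq_zero.1 this

/-! ### Partial fractions -/

/-- The part of the generating function at the origin that survives at the pole where the first
return series takes the value `γ`. -/
def residue (γ : ℂ) : PowerSeries ℂ :=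
  C (√2 - γ)⁻¹ * (C (√2 : ℂ) * (1 + X ^ 2) - ret - C γ)

/-- The conjugate root is √2(1 + X²) - ret, which is where the second factor of `residue` comes
from. -/
theorem ret_quadratic : ret ^ 2 - C (√2 : ℂ) * (1 + X ^ 2) * ret + X ^ 2 = 0 := by
  have hr := two_mul_inv_sqrt_two_sq
  have hs : C (√2 : ℂ) * C (√2 : ℂ)⁻¹ = (1 : PowerSeries ℂ) := C_mul_C_inv sqrt_two_ne_zero
  rw [ret]
  linear_combination (-X ^ 2 * C (√2 : ℂ)⁻¹ ^ 2) * two_mul_refl -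
    X ^ 2 * (1 + X ^ 2) * (1 + refl) * hs + X ^ 2 * (X ^ 2 + refl + X ^ 2 * refl) * hr

theorem one_sub_mul_geom_add (η : ℂ) :
    (1 - C (η ^ 2) * X ^ 2) * (geom η + geom (-η)) = 2 := by
  have h1 := one_sub_mul_geom η
  have h2 := one_sub_mul_geom (-η)
  rw [map_neg] at h2
  rw [map_pow]
  linear_combination (1 + C η * X) * h1 + (1 - C η * X) * h2

/-- Partial fraction decomposition at the poles belonging to `γ`. -/
theorem one_sub_ret_mul_residue {γ η : ℂ} (hγ : ‖γ‖ = 1) (hη : η ^ 2 = (poleSq γ)⁻¹) :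
    (1 - C γ⁻¹ * ret) * (residue γ * (geom η + geom (-η))) = 2 := by
  have hγ0 : C γ * C γ⁻¹ = (1 : PowerSeries ℂ) := C_mul_C_inv (ne_zero_of_norm hγ)
  have hs : (C (√2 : ℂ) - C γ) * C (√2 - γ)⁻¹ = (1 : PowerSeries ℂ) := by
    rw [← map_sub]
    exact C_mul_C_inv (sqrt_two_sub_ne_zero hγ)
  have hw : C γ * (C (√2 : ℂ) - C γ) * C (η ^ 2) = 1 - C (√2 : ℂ) * C γ := by
    rw [hη, ← map_sub, ← map_mul, ← map_mul, ← map_mul, ← poleSq_mul hγ, ← map_one C, ← map_sub]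
    congr 1
    field_simp [ne_zero_of_norm (norm_poleSq hγ)]
  have h : (1 - C γ⁻¹ * ret) * residue γ = 1 - C (η ^ 2) * X ^ 2 := by
    rw [residue]
    -- This is the quadratic evaluated at γ, up to sign: a polynomial in X² with its only zero at X²
    -- = `poleSq γ`.
    have key : (C γ - ret) * (C (√2 : ℂ) * (1 + X ^ 2) - ret - C γ) =
        C γ * (C (√2 : ℂ) - C γ) * (1 - C (η ^ 2) * X ^ 2) := by
      linear_combination ret_quadratic + X ^ 2 * hw
    have e : (1 - C γ⁻¹ * ret) = C γ⁻¹ * (C γ - ret) := by linear_combination -hγ0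
    rw [e]
    linear_combination C γ⁻¹ * C (√2 - γ)⁻¹ * key + (1 - C (η ^ 2) * X ^ 2) * (hs +
      (C (√2 : ℂ) - C γ) * C (√2 - γ)⁻¹ * hγ0)
  rw [← mul_assoc, h, one_sub_mul_geom_add]

/-- The value of `residue γ` at a point where the reflection series has value `v`; `w` is the
square of the point. -/
def residueVal (γ w v : ℂ) : ℂ := (√2 - γ)⁻¹ * (√2 * (1 + w) - (√2 : ℂ)⁻¹ * w * (1 + v) - γ)

/-! ### Values at a point of convergence -/

section Values

variable {ζ v : ℂ}

theorem absEval_ret (hv : AbsEval ζ refl v) : AbsEval ζ ret ((√2 : ℂ)⁻¹ * ζ ^ 2 * (1 + v)) :=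
  ((AbsEval.const _ _).mul ((AbsEval.var ζ).pow 2)).mul ((AbsEval.one ζ).add hv)

theorem absEval_ratio (hv : AbsEval ζ refl v) : AbsEval ζ ratio ((√2 : ℂ)⁻¹ * ζ * (v - 1)) :=
  ((AbsEval.const _ _).mul (AbsEval.var ζ)).mul (hv.sub (AbsEval.one ζ))

theorem absEval_residue (γ : ℂ) (hv : AbsEval ζ refl v) :
    AbsEval ζ (residue γ) (residueVal γ (ζ ^ 2) v) :=
  (AbsEval.const _ _).mul ((((AbsEval.const _ _).mul
    ((AbsEval.one ζ).add ((AbsEval.var ζ).pow 2))).sub (absEval_ret hv)).sub (AbsEval.const _ _))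

theorem two_mul_of_absEval_refl (hv : AbsEval ζ refl v) : 2 * v = ζ ^ 2 * (v ^ 2 - 1) := by
  have h1 := (AbsEval.const ζ 2).mul hv
  rw [map_ofNat, two_mul_refl] at h1
  exact h1.unique (((AbsEval.var ζ).pow 2).mul ((hv.pow 2).sub (AbsEval.one ζ)))

/-- The value of `numer` at a point `ζ` where the reflection series has value `v`. -/
def numerVal (α β p q ζ v : ℂ) : ℤ → Fin 2 → ℂ :=
  let A := α - (√2 : ℂ)⁻¹ * ζ ^ 2 * (1 + v) * p * β
  let B := β + (√2 : ℂ)⁻¹ * ζ ^ 2 * (1 + v) * q * α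
  let ρ := (√2 : ℂ)⁻¹ * ζ * (v - 1)
  fun
  | .ofNat 0 => ![A, B]
  | .ofNat (n + 1) => ![p * v * (-ζ * B * ρ ^ n), -ζ * B * ρ ^ n]
  | .negSucc n => ![ζ * A * (-ρ) ^ n, -q * v * (ζ * A * (-ρ) ^ n)]

theorem absEval_numer (α β p q : ℂ) (hv : AbsEval ζ refl v) (x : ℤ) (i : Fin 2) :
    AbsEval ζ (numer α β p q x i) (numerVal α β p q ζ v x i) := by
  have hA := (AbsEval.const ζ α).sub
    (((absEval_ret hv).mul (AbsEval.const ζ p)).mul (AbsEval.const ζ β))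
  have hB := (AbsEval.const ζ β).add
    (((absEval_ret hv).mul (AbsEval.const ζ q)).mul (AbsEval.const ζ α))
  have hρ := absEval_ratio hv
  match x with
  | .ofNat 0 =>
    fin_cases i
    exacts [hA, hB]
  | .ofNat (n + 1) =>
    have h := ((AbsEval.var ζ).neg.mul hB).mul (hρ.pow n)
    fin_cases i
    exacts [((AbsEval.const ζ p).mul hv).mul h, h]
  | .negSucc n =>
    have h := ((AbsEval.var ζ).mul hA).mul (hρ.neg.pow n)
    fin_cases i
    exacts [h, ((AbsEval.const ζ q).neg.mul hv).mul h]

end Values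

/-! ### Residues and weights at the poles -/

/-- Either the pole belonging to `γ` is absent, or the first return series takes the value `γ`
there. -/
theorem residueVal_dichotomy {γ w v : ℂ} (hγ : ‖γ‖ = 1) (hw : w = poleSq γ)
    (hv : 2 * v = w * (v ^ 2 - 1)) (hv1 : ‖v‖ ≤ 1) :
    (residueVal γ w v = 0 ∧ 1 / √2 ≤ γ.re) ∨
      (γ.re ≤ 1 / √2 ∧ v = -γ / (√2 - γ) ∧ (√2 : ℂ)⁻¹ * w * (1 + v) = γ ∧
        ‖residueVal γ w v‖ = 2 * |(1 - √2 * γ.re) / (3 - 2 * √2 * γ.re)|) := by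
  have hs := sqrt_two_sub_ne_zero hγ
  have hn := normSq_sqrt_two_sub hγ
  have hw1 := poleSq_mul hγ
  rw [← hw] at hw1
  have hs0 := sqrt_two_ne_zero
  have hs2 := sqrt_two_sq
  have hpos := three_sub_pos (re_le_one hγ)
  have hγ0 := ne_zero_of_norm hγ
  have hRpos : 0 < √2 := by positivity
  -- At w = `poleSq γ` the quadratic for v splits, with roots -γ/(√2 - γ) and (√2 - γ)/γ.
  have hprod : ((√2 - γ) * v + γ) * (γ * v - (√2 - γ)) = 0 := by
    linear_combination (-(1 - √2 * γ)) * hv - (v ^ 2 - 1) * hw1 - v * hs2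
  have hc : γ * conj γ = 1 := by rw [Complex.mul_conj', hγ]; norm_num
  rcases mul_eq_zero.1 hprod with h | h
  · have hv' : v = -γ / (√2 - γ) := by
      rw [eq_div_iff hs]
      linear_combination h
    have hg : (√2 : ℂ)⁻¹ * w * (1 + v) = γ := by
      have h1 : (√2 - γ) * (w * (1 + v) - √2 * γ) = 0 := by
        linear_combination w * h + √2 * hw1 + w * γ * hs2
      rw [mul_assoc, sub_eq_zero.1 ((mul_eq_zero.1 h1).resolve_left hs), inv_mul_cancel_left₀ hs0]
    right
    have hle : γ.re ≤ 1 / √2 := by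
      rw [hv', norm_div, norm_neg, hγ, div_le_one (norm_pos_iff.2 hs),
        ← one_le_sq_iff₀ (norm_nonneg _), hn] at hv1
      rw [le_div_iff₀ hRpos]
      linarith
    refine ⟨hle, hv', hg, ?_⟩
    have hk : residueVal γ w v * ((√2 - γ) * (1 - √2 * γ)) =
        γ * ((2 * (√2 * γ.re - 1) : ℝ) : ℂ) := by
      have hre : (2 * γ.re : ℂ) = γ + conj γ := by rw [Complex.add_conj]; push_cast; ring
      rw [residueVal, hg]
      push_cast
      field_simp
      linear_combination √2 * hw1 - √2 * γ * hre - √2 * hc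
    have hk' := congrArg norm hk
    rw [norm_mul, norm_mul, norm_one_sub_sqrt_two_mul hγ, ← sq, hn, norm_mul, hγ, one_mul,
      Complex.norm_real, Real.norm_eq_abs, abs_mul, abs_sub_comm] at hk'
    rw [abs_div, abs_of_pos hpos, ← mul_div_assoc, eq_div_iff hpos.ne', hk']
    norm_num
  · have hv' : γ * v = √2 - γ := by linear_combination h
    left
    constructor
    · have h1 : γ * (1 + v) = √2 := by linear_combination h
      -- Here `ret` takes the value w/γ, so it is the conjugate root that equals γ and the residue
      -- vanishes.
      have h2 : (√2 : ℂ)⁻¹ * γ * (1 + v) = 1 := by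
        rw [mul_assoc, h1, inv_mul_cancel₀ hs0]
      have h3 : γ * (√2 * (1 + w) - (√2 : ℂ)⁻¹ * w * (1 + v) - γ) = 0 := by
        linear_combination (-w) * h2 - hw1
      rw [residueVal, (mul_eq_zero.1 h3).resolve_left hγ0, mul_zero]
    · have hvn : ‖v‖ = ‖√2 - γ‖ := by rw [← hv', norm_mul, hγ, one_mul]
      rw [hvn, ← sq_le_one_iff₀ (norm_nonneg _), hn] at hv1
      rw [div_le_iff₀ hRpos]
      linarith

theorem normSq_add (a b : ℂ) : ‖a + b‖ ^ 2 = ‖a‖ ^ 2 + ‖b‖ ^ 2 + 2 * (a * conj b).re := by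
  simp only [← Complex.normSq_eq_norm_sq, Complex.normSq_add]

/-- The total weight of `numerVal` at a site, at a pole where the first return series has the
value `γ`. -/
theorem normSq_numerVal {α β p q γ ζ v : ℂ} (hαβ : ‖α‖ ^ 2 + ‖β‖ ^ 2 = 1) (hγ : ‖γ‖ = 1)
    (hp : ‖p‖ = 1) (hq : ‖q‖ = 1) (hpq : γ ^ 2 * p * q = -1) (hζ : ‖ζ‖ = 1)
    (hv : v = -γ / (√2 - γ)) (hg : (√2 : ℂ)⁻¹ * ζ ^ 2 * (1 + v) = γ) (x : ℤ) :
    ‖numerVal α β p q ζ v x 0‖ ^ 2 + ‖numerVal α β p q ζ v x 1‖ ^ 2 =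
      2 * (1 + 2 * (γ * q * α * conj β).re) * (delta0 x + (1 - delta0 x) *
        (2 - √2 * γ.re) * (1 / (3 - 2 * √2 * γ.re)) ^ x.natAbs) := by
  have hs := sqrt_two_sub_ne_zero hγ
  have hpos := three_sub_pos (re_le_one hγ)
  have hn := normSq_sqrt_two_sub hγ
  have hR2 : √2 ^ 2 = 2 := Real.sq_sqrt (by norm_num)
  have hu : conj (γ * p) * (γ * p) = 1 := by
    rw [Complex.conj_mul', norm_mul, hγ, hp]; norm_num
  -- This relation gives both origin components the same modulus, hence the symmetry in x.
  have hconj : conj (γ * p) = -(γ * q) := by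
    have h0 := ne_zero_of_norm (z := γ * p) (by rw [norm_mul, hγ, hp, one_mul])
    refine mul_right_cancel₀ h0 ?_
    linear_combination hu + hpq
  have hA : ‖α - γ * p * β‖ ^ 2 = 1 + 2 * (γ * q * α * conj β).re := by
    rw [sub_eq_add_neg, normSq_add, norm_neg, norm_mul, norm_mul, hγ, hp, one_mul, one_mul, hαβ,
      map_neg, map_mul, hconj]
    congr 3
    ring
  have hB : ‖β + γ * q * α‖ ^ 2 = 1 + 2 * (γ * q * α * conj β).re := by
    rw [add_comm, normSq_add, norm_mul, norm_mul, hγ, hq, one_mul, one_mul, hαβ]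
  have hvn : ‖v‖ ^ 2 = 1 / (3 - 2 * √2 * γ.re) := by
    rw [hv, norm_div, norm_neg, hγ, div_pow, hn, one_pow]
  have hρn : ‖(√2 : ℂ)⁻¹ * ζ * (v - 1)‖ ^ 2 = 1 / (3 - 2 * √2 * γ.re) := by
    have h1 : v - 1 = -√2 / (√2 - γ) := by
      rw [hv]
      field_simp
      ring
    rw [h1, norm_mul, norm_mul, hζ, norm_div, norm_neg, norm_inv, mul_one, mul_pow, div_pow, hn,
      Complex.norm_real, Real.norm_eq_abs, inv_pow, sq_abs, hR2]
    ring
  have hsum : 1 + 1 / (3 - 2 * √2 * γ.re) =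
      2 * (2 - √2 * γ.re) * (1 / (3 - 2 * √2 * γ.re)) := by
    field_simp
    ring
  match x with
  | .ofNat 0 =>
    change ‖α - (√2 : ℂ)⁻¹ * ζ ^ 2 * (1 + v) * p * β‖ ^ 2 +
      ‖β + (√2 : ℂ)⁻¹ * ζ ^ 2 * (1 + v) * q * α‖ ^ 2 = _
    rw [hg, hA, hB]
    simp [delta0]
    ring
  | .ofNat (n + 1) =>
    have hx : delta0 (Int.ofNat (n + 1)) = 0 := if_neg (by simp; omega)
    have hN : (Int.ofNat (n + 1)).natAbs = n + 1 := rfl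
    simp only [numerVal, Matrix.cons_val_zero, Matrix.cons_val_one, hg, hx, hN]
    generalize (√2 : ℂ)⁻¹ * ζ * (v - 1) = ρ at hρn ⊢
    have hρ : (‖ρ‖ ^ n) ^ 2 = (1 / (3 - 2 * √2 * γ.re)) ^ n := by
      rw [← pow_mul, mul_comm n 2, pow_mul, hρn]
    simp only [norm_mul, norm_neg, norm_pow, hp, hζ, mul_pow, hB, hvn, hρ]
    linear_combination (1 + 2 * (γ * q * α * conj β).re) *
      (1 / (3 - 2 * √2 * γ.re)) ^ n * hsum
  | .negSucc n =>
    have hx : delta0 (Int.negSucc n) = 0 := if_neg (by omega)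
    have hN : (Int.negSucc n).natAbs = n + 1 := rfl
    simp only [numerVal, Matrix.cons_val_zero, Matrix.cons_val_one, hg, hx, hN]
    generalize (√2 : ℂ)⁻¹ * ζ * (v - 1) = ρ at hρn ⊢
    have hρ : (‖ρ‖ ^ n) ^ 2 = (1 / (3 - 2 * √2 * γ.re)) ^ n := by
      rw [← pow_mul, mul_comm n 2, pow_mul, hρn]
    simp only [norm_mul, norm_neg, norm_pow, hq, hζ, mul_pow, hA, hvn, hρ]
    linear_combination (1 + 2 * (γ * q * α * conj β).re) *
      (1 / (3 - 2 * √2 * γ.re)) ^ n * hsum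

/-- The contribution of the poles belonging to `γ` to the limit measure, where `c` is the real
part of `γ` and `a` the interference term of the initial state. -/
def weight (c a : ℝ) (x : ℤ) : ℝ :=
  if c ≤ 1 / √2 then
    ((1 - √2 * c) / (3 - 2 * √2 * c)) ^ 2 * (1 + 2 * a) *
      (delta0 x + (1 - delta0 x) * (2 - √2 * c) * (1 / (3 - 2 * √2 * c)) ^ x.natAbs)
  else 0

/-- The two poles ±ζ carry half of the weight each. -/
theorem normSq_pole_amplitude {α β p q γ ζ v : ℂ} (hαβ : ‖α‖ ^ 2 + ‖β‖ ^ 2 = 1) (hγ : ‖γ‖ = 1)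
    (hp : ‖p‖ = 1) (hq : ‖q‖ = 1) (hpq : γ ^ 2 * p * q = -1) (hζ : ζ ^ 2 = poleSq γ)
    (hζ1 : ‖ζ‖ = 1) (hv : AbsEval ζ refl v) (hv1 : ‖v‖ ≤ 1) (x : ℤ) :
    ‖1 / 4 * residueVal γ (ζ ^ 2) v * numerVal α β p q ζ v x 0‖ ^ 2 +
      ‖1 / 4 * residueVal γ (ζ ^ 2) v * numerVal α β p q ζ v x 1‖ ^ 2 =
        1 / 2 * weight γ.re (γ * q * α * conj β).re x := by
  have h4 : ‖(1 / 4 : ℂ)‖ = 1 / 4 := by norm_num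
  simp only [norm_mul, h4, mul_pow]
  rw [← mul_add]
  rcases residueVal_dichotomy hγ hζ (two_mul_of_absEval_refl hv) hv1 with
    ⟨h0, hc⟩ | ⟨hc, hv', hg, hk⟩
  · rw [h0, weight]
    -- If Re γ = 1/√2, `weight` is in its nontrivial branch, but its factor 1 - √2 Re γ is zero.
    split_ifs with h
    · have h1 : 1 - √2 * γ.re = 0 := by
        rw [le_antisymm h hc]
        field_simp
        ring
      simp [h1]
    · simp
  · rw [normSq_numerVal hαβ hγ hp hq hpq hζ1 hv' hg, hk, weight, if_pos hc, mul_pow, sq_abs]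
    ring

/-! ### The limit measure as a sum over poles -/

/-- The time averages of the probabilities converge, to the sum of the contributions of the two
families of poles. -/
theorem isTimeAveragedLimitMeasure_weight {σp σm : ℝ} {α β p q γ : ℂ}
    (hαβ : ‖α‖ ^ 2 + ‖β‖ ^ 2 = 1) (hγ : ‖γ‖ = 1) (hp : p = Complex.exp (Complex.I * σp))
    (hq : q = Complex.exp (-(Complex.I * σm))) (hpq : γ ^ 2 * p * q = -1) :
    IsTimeAveragedLimitMeasure (prob σp σm α β) fun x =>
      weight γ.re (γ * q * α * conj β).re x + weight (-γ).re (-γ * q * α * conj β).re x := by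
  have hpn : ‖p‖ = 1 := by rw [hp, mul_comm, Complex.norm_exp_ofReal_mul_I]
  have hqn : ‖q‖ = 1 := by
    rw [hq, ← mul_neg, mul_comm, ← Complex.ofReal_neg, Complex.norm_exp_ofReal_mul_I]
  let Γ : Bool → ℂ := fun b => if b then γ else -γ
  have hΓ : ∀ b, ‖Γ b‖ = 1 := by simp [Γ, hγ]
  have hΓpq : ∀ b, Γ b ^ 2 * p * q = -1 := by simp [Γ, hpq]
  choose η hη using fun b => IsAlgClosed.exists_pow_nat_eq (poleSq (Γ b))⁻¹ two_pos
  let H : Bool × Bool → ℂ := fun j => if j.2 then η j.1 else -η j.1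
  have hHsq : ∀ j, H j ^ 2 = (poleSq (Γ j.1))⁻¹ := fun ⟨b, d⟩ => by cases d <;> simp [H, hη]
  have hH : ∀ j, ‖H j‖ = 1 := fun j => by
    have h : ‖H j‖ ^ 2 = 1 := by rw [← norm_pow, hHsq, norm_inv, norm_poleSq (hΓ _), inv_one]
    exact (pow_eq_one_iff_of_nonneg (norm_nonneg _) two_ne_zero).1 h
  have hHinv : ∀ j, ‖(H j)⁻¹‖ = 1 := fun j => by rw [norm_inv, hH, inv_one]
  have hHisq : ∀ j, (H j)⁻¹ ^ 2 = poleSq (Γ j.1) := fun j => by rw [inv_pow, hHsq, inv_inv]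
  choose v hv hv1 using fun j => exists_absEval_refl (hHinv j)
  -- The factor 1/4 is 1/2 from splitting 1/(1 - u²) into 1/(1 - u) and 1/(1 + u), and 1/2 from the
  -- pair ±η.
  let D : PowerSeries ℂ := ∑ j, C (1 / 4) * residue (Γ j.1) * geom (H j)
  have hD : D * (1 + ret ^ 2 * C p * C q) = 1 := by
    have ht := one_sub_ret_mul_residue (hΓ true) (hη true)
    have hf := one_sub_ret_mul_residue (hΓ false) (hη false)
    have e : D = C (1 / 4) * (residue (Γ true) * (geom (η true) + geom (-η true)) +
        residue (Γ false) * (geom (η false) + geom (-η false))) := by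
      simp only [D, Fintype.sum_prod_type, Fintype.sum_bool, H]
      simp only [if_true, Bool.false_eq_true, if_false]
      ring
    have h4 : C (1 / 4 : ℂ) * 4 = (1 : PowerSeries ℂ) := by
      rw [← map_ofNat (C (R := ℂ)) 4, ← map_mul]
      norm_num
    have hneg : C (Γ false)⁻¹ = -C (Γ true)⁻¹ := by
      rw [← map_neg]
      simp [Γ, inv_neg]
    have hpq' : C p * C q = -C (Γ true)⁻¹ ^ 2 := by
      rw [← map_mul, ← map_pow, ← map_neg]
      congr 1
      have := hΓpq true
      have h0 := ne_zero_of_norm (hΓ true)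
      field_simp
      linear_combination this
    rw [hneg] at hf
    rw [e]
    linear_combination C (1 / 4 : ℂ) * (1 + C (Γ true)⁻¹ * ret) * ht +
      C (1 / 4 : ℂ) * (1 - C (Γ true)⁻¹ * ret) * hf + h4 + C (1 / 4) * (residue (Γ true) *
      (geom (η true) + geom (-η true)) + residue (Γ false) * (geom (η false) + geom (-η false))) *
      ret ^ 2 * hpq'
  obtain ⟨V, hV, hVsum, hVre⟩ : ∃ V : ℤ → Fin 2 → Bool × Bool → ℂ,
      (∀ x i j, AbsEval (H j)⁻¹ (C (1 / 4) * residue (Γ j.1) * numer α β p q x i) (V x i j)) ∧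
      (∀ x j, ‖V x 0 j‖ ^ 2 + ‖V x 1 j‖ ^ 2 =
        1 / 2 * weight (Γ j.1).re (Γ j.1 * q * α * conj β).re x) ∧
      ∀ x i j, V x i j ≠ 0 → (Γ j.1).re ≤ 1 / √2 := by
    refine ⟨fun x i j => 1 / 4 * residueVal (Γ j.1) ((H j)⁻¹ ^ 2) (v j) *
      numerVal α β p q (H j)⁻¹ (v j) x i, fun x i j => ?_, fun x j => ?_, fun x i j h => ?_⟩
    · exact ((AbsEval.const _ _).mul (absEval_residue _ (hv j))).mul
        (absEval_numer α β p q (hv j) x i)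
    · exact normSq_pole_amplitude hαβ (hΓ j.1) hpn hqn (hΓpq j.1) (hHisq j) (hHinv j) (hv j)
        (hv1 j) x
    · rcases residueVal_dichotomy (hΓ _) (hHisq j) (two_mul_of_absEval_refl (hv j)) (hv1 j) with
        h' | h'
      · exact absurd h'.1 (right_ne_zero_of_mul (left_ne_zero_of_mul h))
      · exact h'.1
  -- Poles of γ and -γ can only collide when γ = ±1; then one of them has real part 1 > 1/√2 and
  -- carries no amplitude.
  have hne : ∀ x i j k, j ≠ k → V x i j ≠ 0 → V x i k ≠ 0 → H j ≠ H k := by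
    intro x i j k hjk hj hk h
    have hj' := hVre x i j hj
    have hk' := hVre x i k hk
    have hw : poleSq (Γ j.1) = poleSq (Γ k.1) := by rw [← hHisq, ← hHisq, h]
    have hη0 : ∀ b, η b ≠ 0 := fun b => ne_zero_of_norm (hH (b, true))
    have hη1 : ∀ b, η b ≠ -η b := fun b hb => hη0 b (self_eq_neg.1 hb)
    have hlt : 1 / √2 < 1 := by
      rw [div_lt_one (by positivity)]
      linarith [sqrt_two_gt]
    have hΓ1 : poleSq γ = poleSq (-γ) → γ.re ≤ 1 / √2 → (-γ).re ≤ 1 / √2 → False := by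
      intro h1 h2 h3
      rcases sq_eq_one_iff.1 (poleSq_ne_poleSq_neg hγ h1) with h4 | h4
      · rw [h4, Complex.one_re] at h2
        linarith
      · rw [h4, neg_neg, Complex.one_re] at h3
        linarith
    obtain ⟨b, d⟩ := j
    obtain ⟨b', d'⟩ := k
    cases b <;> cases b'
    · cases d <;> cases d'
      exacts [hjk rfl, hη1 _ h.symm, hη1 _ h, hjk rfl]
    · exact hΓ1 hw.symm hk' hj'
    · exact hΓ1 hw hj' hk'
    · cases d <;> cases d'
      exacts [hjk rfl, hη1 _ h.symm, hη1 _ h, hjk rfl]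
  intro x
  have hlim : ∀ i, Tendsto (fun T : ℕ => (1 / (T : ℝ)) *
      ∑ t ∈ Finset.range T, ‖amplitude σp σm α β t x i‖ ^ 2) atTop (𝓝 (∑ j, ‖V x i j‖ ^ 2)) := by
    intro i
    refine tendsto_average_normSq _ (V x i) H hH (hne x i) ?_
    have hj : ∀ j, Tendsto (fun t => coeff t ((C (1 / 4) * residue (Γ j.1) *
        numer α β p q x i) * geom (H j)) - V x i j * H j ^ t) atTop (𝓝 0) := fun j =>
      tendsto_coeff_mul_geom (hH j) (hV x i j)
    have hs := tendsto_finsetSum Finset.univ fun j _ => hj j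
    rw [Finset.sum_const_zero] at hs
    refine hs.congr fun t => ?_
    have e : numer α β p q x i * D =
        ∑ j, C (1 / 4) * residue (Γ j.1) * numer α β p q x i * geom (H j) := by
      rw [Finset.mul_sum]
      refine Finset.sum_congr rfl fun j _ => ?_
      ring
    rw [Finset.sum_sub_distrib, amplitude_eq_coeff_numer hp hq hD, e, map_sum]
  have hsum := (hlim 0).add (hlim 1)
  have hval : ∑ j, ‖V x 0 j‖ ^ 2 + ∑ j, ‖V x 1 j‖ ^ 2 =
      weight γ.re (γ * q * α * conj β).re x + weight (-γ).re (-γ * q * α * conj β).re x := by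
    rw [← Finset.sum_add_distrib]
    simp only [hVsum]
    simp only [Fintype.sum_prod_type, Fintype.sum_bool, Γ]
    simp only [if_true, Bool.false_eq_true, if_false]
    ring
  rw [hval] at hsum
  refine hsum.congr fun T => ?_
  rw [← mul_add, ← Finset.sum_add_distrib]
  rfl

/-! ### Symmetry, decay and the explicit weights -/

theorem weight_neg (c a : ℝ) (x : ℤ) : weight c a (-x) = weight c a x := by
  simp [weight, delta0]

theorem exists_weight_le (c a : ℝ) :
    ∃ K r : ℝ, 0 < K ∧ 0 < r ∧ r < 1 ∧ ∀ x, weight c a x ≤ K * r ^ x.natAbs := by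
  have hR0 : 0 < √2 := by positivity
  rcases lt_or_ge c (1 / √2) with hc | hc
  · have hc' : √2 * c < 1 := by rwa [lt_div_iff₀ hR0, mul_comm] at hc
    set m := 1 / (3 - 2 * √2 * c) with hm
    have hd : 1 < 3 - 2 * √2 * c := by linarith
    have hm0 : 0 < m := one_div_pos.2 (by linarith)
    have hm1 : m < 1 := (div_lt_one (by linarith)).2 hd
    set k := ((1 - √2 * c) / (3 - 2 * √2 * c)) ^ 2
    have hk : 0 < k := by
      have : 0 < (1 - √2 * c) / (3 - 2 * √2 * c) := div_pos (by linarith) (by linarith)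
      positivity
    -- Using |a| keeps the constant positive even when 1 + 2a is not.
    refine ⟨k * (1 + 2 * |a|) * (2 - √2 * c), m, ?_, hm0, hm1, fun x => ?_⟩
    · have : 0 < 2 - √2 * c := by linarith
      positivity
    · rw [weight, if_pos hc.le, ← hm, mul_assoc (k * (1 + 2 * |a|))]
      change k * (1 + 2 * a) * _ ≤ _
      have hE : 0 ≤ delta0 x + (1 - delta0 x) * (2 - √2 * c) * m ^ x.natAbs ∧
          delta0 x + (1 - delta0 x) * (2 - √2 * c) * m ^ x.natAbs ≤
            (2 - √2 * c) * m ^ x.natAbs := by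
        rw [delta0]
        split_ifs with h
        · subst h
          norm_num
          linarith
        · have : 0 < 2 - √2 * c := by linarith
          constructor
          · simp only [zero_add, sub_zero, one_mul]
            positivity
          · simp
      refine mul_le_mul (mul_le_mul_of_nonneg_left ?_ hk.le) hE.2 hE.1 (by positivity)
      linarith [le_abs_self a]
  -- At c = 1/√2 the geometric rate degenerates to 1, but the prefactor vanishes, so any rate
  -- serves.
  · refine ⟨1, 1 / 2, one_pos, by norm_num, by norm_num, fun x => ?_⟩
    have h0 : weight c a x = 0 := by
      rw [weight]
      split_ifs with h
      · have h1 : 1 - √2 * c = 0 := by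
          rw [le_antisymm h hc]
          field_simp
          ring
        simp [h1]
      · rfl
    rw [h0]
    positivity

theorem indicator_mul_nuMinus (σ τ : ℝ) (α β : ℂ) (x : ℤ) :
    Set.indicator (Set.Icc (-1) (1 / √2)) (fun _ => (1 : ℝ)) (Real.sin σ) * nuMinus σ τ α β x =
      weight (Real.sin σ)
        (Complex.I * Complex.exp (-(Complex.I * τ)) * α * conj β).re x := by
  rw [weight]
  split_ifs with h
  · rw [Set.indicator_of_mem (Set.mem_Icc.2 ⟨Real.neg_one_le_sin σ, h⟩), one_mul, nuMinus]
  · rw [Set.indicator_of_notMem fun h' => h h'.2, zero_mul]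

theorem indicator_mul_nuPlus (σ τ : ℝ) (α β : ℂ) (x : ℤ) :
    Set.indicator (Set.Icc (-1 / √2) 1) (fun _ => (1 : ℝ)) (Real.sin σ) * nuPlus σ τ α β x =
      weight (-Real.sin σ)
        (-(Complex.I * Complex.exp (-(Complex.I * τ)) * α * conj β).re) x := by
  have hiff : -Real.sin σ ≤ 1 / √2 ↔ -1 / √2 ≤ Real.sin σ := by rw [neg_le, neg_div]
  rw [weight]
  split_ifs with h
  · rw [Set.indicator_of_mem (Set.mem_Icc.2 ⟨hiff.1 h, Real.sin_le_one σ⟩), one_mul, nuPlus]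
    simp only [mul_neg, sub_eq_add_neg, neg_neg]
  · rw [Set.indicator_of_notMem fun h' => h (hiff.2 h'.1), zero_mul]

end TwoPhaseWalk

end

open TwoPhaseWalk in
theorem theorem2 (σp σm : ℝ) (α β : ℂ) (hαβ : ‖α‖ ^ 2 + ‖β‖ ^ 2 = 1)
    (σ τ : ℝ) (hσ : σ = (σp - σm) / 2) (hτ : τ = (σp + σm) / 2) :
    ∃ μ : ℤ → ℝ,
      TwoPhaseWalk.IsTimeAveragedLimitMeasure (TwoPhaseWalk.prob σp σm α β) μ ∧
      (∀ x : ℤ, μ x =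
        Set.indicator (Set.Icc (-1 / √2) 1) (fun _ => (1 : ℝ)) (Real.sin σ) *
            TwoPhaseWalk.nuPlus σ τ α β x +
          Set.indicator (Set.Icc (-1) (1 / √2)) (fun _ => (1 : ℝ)) (Real.sin σ) *
            TwoPhaseWalk.nuMinus σ τ α β x) ∧
      (∀ x : ℤ, μ (-x) = μ x) ∧
      (∃ C r : ℝ, 0 < C ∧ 0 < r ∧ r < 1 ∧ ∀ x : ℤ, μ x ≤ C * r ^ x.natAbs ∧ 0 ≤ μ x) := by
  set a := (Complex.I * Complex.exp (-(Complex.I * τ)) * α * (starRingEnd ℂ) β).re with ha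
  have hexp : Complex.exp (-(Complex.I * σ)) = Complex.exp ((-σ : ℝ) * Complex.I) := by
    congr 1
    push_cast
    ring
  -- Since pq = e^{2iσ}, the number i e^{-iσ} is a square root of -1/(pq).
  have hγ : ‖Complex.I * Complex.exp (-(Complex.I * σ))‖ = 1 := by
    rw [norm_mul, Complex.norm_I, one_mul, hexp, Complex.norm_exp_ofReal_mul_I]
  have hre : (Complex.I * Complex.exp (-(Complex.I * σ))).re = Real.sin σ := by
    rw [hexp, Complex.I_mul_re, Complex.exp_ofReal_mul_I_im, Real.sin_neg, neg_neg]
  have hpq : (Complex.I * Complex.exp (-(Complex.I * σ))) ^ 2 * Complex.exp (Complex.I * σp) *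
      Complex.exp (-(Complex.I * σm)) = -1 := by
    rw [mul_pow, Complex.I_sq, ← Complex.exp_nat_mul, mul_assoc, mul_assoc, ← Complex.exp_add,
      ← Complex.exp_add, hσ]
    have : ((2 : ℕ) : ℂ) * -(Complex.I * (((σp - σm) / 2 : ℝ) : ℂ)) +
        (Complex.I * σp + -(Complex.I * σm)) = 0 := by
      push_cast
      ring
    rw [this, Complex.exp_zero, mul_one]
  have hγq : Complex.I * Complex.exp (-(Complex.I * σ)) * Complex.exp (-(Complex.I * σm)) =
      Complex.I * Complex.exp (-(Complex.I * τ)) := by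
    rw [mul_assoc, ← Complex.exp_add, hσ, hτ]
    congr 2
    push_cast
    ring
  have hlim := isTimeAveragedLimitMeasure_weight hαβ hγ rfl rfl hpq
  simp only [neg_mul, Complex.neg_re, hre, hγq, ← ha] at hlim
  refine ⟨_, hlim, fun x => ?_, fun x => ?_, ?_⟩
  · rw [indicator_mul_nuMinus, indicator_mul_nuPlus, add_comm]
  · simp only [weight_neg]
  · obtain ⟨K₁, r₁, hK₁, hr₁, hr₁', h₁⟩ := exists_weight_le (Real.sin σ) a
    obtain ⟨K₂, r₂, hK₂, hr₂, hr₂', h₂⟩ := exists_weight_le (-Real.sin σ) (-a)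
    refine ⟨K₁ + K₂, max r₁ r₂, by positivity, lt_max_of_lt_left hr₁, max_lt hr₁' hr₂',
      fun x => ⟨?_, ?_⟩⟩
    · rw [add_mul]
      refine add_le_add ((h₁ x).trans ?_) ((h₂ x).trans ?_)
      · gcongr
        exact le_max_left _ _
      · gcongr
        exact le_max_right _ _
    -- Nonnegativity passes to the limit from the averages, so the sign of 1 ± 2a need not be
    -- examined.
    · refine ge_of_tendsto' (hlim x) fun T => ?_
      have : ∀ t, 0 ≤ prob σp σm α β t x := fun t => by
        rw [prob]
        positivity
      exact mul_nonneg (by positivity) (Finset.sum_nonneg fun t _ => this t)
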